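/- Let $(\mathbb U,d)$ be the Urysohn space, i.e. the (up to isometry unique) complete separable metric space such that for every finite metric space $X$ and every $X_0\subseteq X$, each isometric embedding $X_0\to\mathbb U$ extends to an isometric embedding $X\to\mathbb U$. A $1$-Lipschitz retraction of a metric space $X$ is a $1$-Lipschitz map $R\colon X\to X$ with $R\circ R=R$; put $D_R(x)=\operatorname{dist}(x,R[X])$. Let $\mathcal R(\mathbb U)$ be the set of all $1$-Lipschitz retractions of $\mathbb U$. A retraction $U\in\mathcal R(\mathbb U)$ is *universal* if for every separable metric space $X$ and every $1$-Lipschitz retraction $R$ of $X$ there is an isometric embedding $i\colon X\to\mathbb U$ with $i\circ R=U\circ i$ and $D_R=D_U\circ i$. It is *ultrahomogeneous* if every surjective isometry $i\colon A_1\to A_2$ between finite subsets of $\mathbb U$ with $U[A_1]\subseteq A_1$, $i(U(x))=U(i(x))$ and $D_U(x)=D_U(i(x))$ for all $x\in A_1$ extends to a surjective isometry $I\colon\mathbb U\to\mathbb U$ with $I\circ U=U\circ I$ and $D_U=D_U\circ I$. Let $\mathcal U(\mathbb U)\subseteq\mathcal R(\mathbb U)$ be the set of universal ultrahomogeneous retractions,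 $T=\{U[\mathbb U]: U\in\mathcal U(\mathbb U)\}$, and for $t\in T$ let $\mathcal R(\mathbb U,t)$ and $\mathcal U(\mathbb U,t)$ be the sets of those $R$ in $\mathcal R(\mathbb U)$, respectively in $\mathcal U(\mathbb U)$, with $R[\mathbb U]=t$. Let $\tau$ be any one of the following three topologies on $\mathcal R(\mathbb U)$: pointwise convergence $\tau_p$; pointwise retract convergence $\tau_{pr}$ (pointwise convergence of both $R$ and $D_R$); uniform convergence $\tau_u$. Suppose that for some $t\in T$ the set $\mathcal U(\mathbb U,t)$ is $\tau$-dense in the subspace $\mathcal R(\mathbb U,t)$. Then $\mathcal U(\mathbb U)$ is $\tau$-dense in the subspace $\bigcup_{t\in T}\mathcal R(\mathbb U,t)$; that is, the closure of $\mathcal U(\mathbb U)$ taken in that subspace equals $\bigcup_{t\in T}\mathcal R(\mathbb U,t)$. -/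

import Mathlib

open Set Metric Topology

universe u

/-- A metric space is a Urysohn space if it is complete, separable, and every isometric embedding
of a subset of a finite metric space `X` extends to an isometric embedding of `X`.  Up to isometry
there is exactly one such space. -/
structure IsUrysohn (𝕌 : Type u) [MetricSpace 𝕌] : Prop where
  complete : CompleteSpace 𝕌
  separable : TopologicalSpace.SeparableSpace 𝕌
  extension : ∀ (X : Type u) [MetricSpace X] [Finite X] (X₀ : Set X) (f : X₀ → 𝕌), Isometry f →
    ∃ g : X → 𝕌, Isometry g ∧ ∀ x : X₀, g x = f x

/-- 1-Lipschitz retractions of a metric space (onto their range). -/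
def IsLipRetraction {X : Type u} [MetricSpace X] (R : X → X) : Prop :=
  LipschitzWith 1 R ∧ ∀ x, R (R x) = R x

/-- The set `ℛ(𝕌)` of all 1-Lipschitz retractions of `𝕌`, as a type. -/
def Retr (𝕌 : Type u) [MetricSpace 𝕌] : Type u := {R : 𝕌 → 𝕌 // IsLipRetraction R}

/-- `D_R(x) = dist(x, R[X])`. -/
noncomputable def retractDist {X : Type u} [MetricSpace X] (R : X → X) (x : X) : ℝ :=
  infDist x (range R)

/-- A retraction `U` of `𝕌` is universal if every 1-Lipschitz retraction of a separable metric
space embeds in it, preserving the distance to the retract. -/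
def IsUniversalRetraction {𝕌 : Type u} [MetricSpace 𝕌] (U : 𝕌 → 𝕌) : Prop :=
  ∀ (X : Type u) [MetricSpace X] [TopologicalSpace.SeparableSpace X] (R : X → X),
    IsLipRetraction R →
    ∃ i : X → 𝕌, Isometry i ∧ ∀ x, i (R x) = U (i x) ∧ retractDist R x = retractDist U (i x)

/-- A retraction `U` of `𝕌` is ultrahomogeneous if every isomorphism between finite subsets
(closed under `U`, so that `i ∘ U` makes sense) extends to an automorphism of `(𝕌, U, D_U)`. -/
def IsUltrahomogeneousRetraction {𝕌 : Type u} [MetricSpace 𝕌] (U : 𝕌 → 𝕌) : Prop :=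
  ∀ (A₁ A₂ : Set 𝕌) (hU : MapsTo U A₁ A₁) (i : A₁ ≃ᵢ A₂), A₁.Finite → A₂.Finite →
    (∀ x : A₁, (i ⟨U x, hU x.2⟩ : 𝕌) = U (i x)) →
    (∀ x : A₁, retractDist U (x : 𝕌) = retractDist U (i x : 𝕌)) →
    ∃ I : 𝕌 ≃ᵢ 𝕌, (∀ x : A₁, I x = i x) ∧
      ∀ x, I (U x) = U (I x) ∧ retractDist U x = retractDist U (I x)

/-- The set `𝒰(𝕌)` of universal ultrahomogeneous 1-Lipschitz retractions. -/
def univRetr (𝕌 : Type u) [MetricSpace 𝕌] : Set (Retr 𝕌) :=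
  {U | IsUniversalRetraction U.1 ∧ IsUltrahomogeneousRetraction U.1}

/-- The family `T = {U[𝕌] : U ∈ 𝒰(𝕌)}` of subsets of `𝕌`. -/
def univRetracts (𝕌 : Type u) [MetricSpace 𝕌] : Set (Set 𝕌) :=
  {t | ∃ U ∈ univRetr 𝕌, range U.1 = t}

/-- `ℛ(𝕌, t)`: the 1-Lipschitz retractions of `𝕌` onto `t`. -/
def retrOnto {𝕌 : Type u} [MetricSpace 𝕌] (t : Set 𝕌) : Set (Retr 𝕌) := {R | range R.1 = t}

/-- `𝒰(𝕌, t)`: the universal ultrahomogeneous 1-Lipschitz retractions of `𝕌` onto `t`. -/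
def univRetrOnto {𝕌 : Type u} [MetricSpace 𝕌] (t : Set 𝕌) : Set (Retr 𝕌) :=
  {U | U ∈ univRetr 𝕌 ∧ range U.1 = t}

/-- `⋃_{t ∈ T} ℛ(𝕌, t)`. -/
def retrOntoUnivRetracts (𝕌 : Type u) [MetricSpace 𝕌] : Set (Retr 𝕌) :=
  ⋃ t ∈ univRetracts 𝕌, retrOnto t

/-- The topology of pointwise convergence on `ℛ(𝕌)`. -/
@[reducible] noncomputable def tauP (𝕌 : Type u) [MetricSpace 𝕌] : TopologicalSpace (Retr 𝕌) :=
  TopologicalSpace.induced (fun R : Retr 𝕌 => (R.1 : 𝕌 → 𝕌)) inferInstance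

/-- The topology of pointwise retract convergence on `ℛ(𝕌)`: pointwise convergence of both `R`
and `D_R`. -/
@[reducible] noncomputable def tauPR (𝕌 : Type u) [MetricSpace 𝕌] : TopologicalSpace (Retr 𝕌) :=
  TopologicalSpace.induced
    (fun R : Retr 𝕌 => ((R.1, retractDist R.1) : (𝕌 → 𝕌) × (𝕌 → ℝ))) inferInstance

/-- The topology of uniform convergence on `ℛ(𝕌)`. -/
@[reducible] noncomputable def tauU (𝕌 : Type u) [MetricSpace 𝕌] : TopologicalSpace (Retr 𝕌) :=
  TopologicalSpace.induced (fun R : Retr 𝕌 => UniformFun.ofFun R.1)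
    (UniformFun.topologicalSpace 𝕌 𝕌)

/-- `A` is a dense subset of the subspace `B` of `(Z, τ)`. -/
def DenseInSubspace {Z : Type u} (τ : TopologicalSpace Z) (A B : Set Z) : Prop :=
  A ⊆ B ∧ @Dense B (@instTopologicalSpaceSubtype Z (· ∈ B) τ) (Subtype.val ⁻¹' A)

/-- The closure of (the trace of) `A` in the subspace `B` of `(Z, τ)`, as a subset of `Z`. -/
def closureInSubspace {Z : Type u} (τ : TopologicalSpace Z) (A B : Set Z) : Set Z :=
  Subtype.val '' @closure B (@instTopologicalSpaceSubtype Z (· ∈ B) τ) (Subtype.val ⁻¹' A)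

theorem nhds_pi_metric_basis {ι Y : Type*} [PseudoMetricSpace Y] (f : ι → Y) :
    (𝓝 f).HasBasis (fun p : Finset ι × ℝ => 0 < p.2)
      (fun p => {g | ∀ x ∈ p.1, dist (g x) (f x) < p.2}) := by
  refine ⟨fun s => ?_⟩
  rw [nhds_pi,
    (Filter.hasBasis_pi_same_index (fun x => nhds_basis_ball (x := f x)) ?_).mem_iff]
  · constructor
    · rintro ⟨⟨I, ε⟩, ⟨hI, hε⟩, hs⟩
      exact ⟨⟨hI.toFinset, ε⟩, hε, fun R hR => hs fun x hx => hR x (by simpa using hx)⟩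
    · rintro ⟨⟨I, ε⟩, hε, hs⟩
      exact ⟨⟨I, ε⟩, ⟨I.finite_toSet, hε⟩, fun R hR => hs fun x hx => hR x hx⟩
  · intro I k hI hk
    have h : ∀ᶠ δ in 𝓝[>] (0 : ℝ), ∀ i ∈ I, δ < k i :=
      (Filter.eventually_all_finite hI).2 fun i hi =>
        (eventually_lt_nhds (hk i hi)).filter_mono nhdsWithin_le_nhds
    obtain ⟨δ, hδ, hδ'⟩ := (h.and self_mem_nhdsWithin).exists
    exact ⟨δ, hδ', fun i hi => ball_subset_ball (hδ i hi).le⟩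

/-- The basic neighbourhoods of the topology of pointwise convergence. -/
theorem nhds_tauP_basis {𝕌 : Type u} [MetricSpace 𝕌] (U : Retr 𝕌) :
    (@nhds _ (tauP 𝕌) U).HasBasis (fun p : Finset 𝕌 × ℝ => 0 < p.2)
      (fun p => {R | ∀ x ∈ p.1, dist (R.1 x) (U.1 x) < p.2}) := by
  rw [tauP, nhds_induced]
  exact (nhds_pi_metric_basis U.1).comap _

/-- The basic neighbourhoods of the topology of pointwise retract convergence. -/
theorem nhds_tauPR_basis {𝕌 : Type u} [MetricSpace 𝕌] (U : Retr 𝕌) :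
    (@nhds _ (tauPR 𝕌) U).HasBasis (fun p : Finset 𝕌 × ℝ => 0 < p.2)
      (fun p => {R | ∀ x ∈ p.1, dist (R.1 x) (U.1 x) < p.2 ∧
        |retractDist U.1 x - retractDist R.1 x| < p.2}) := by
  classical
  refine ⟨fun s => ?_⟩
  rw [tauPR, nhds_induced, nhds_prod_eq, (((nhds_pi_metric_basis U.1).prod
    (nhds_pi_metric_basis (retractDist U.1))).comap _).mem_iff]
  constructor
  · rintro ⟨⟨⟨I, ε⟩, ⟨J, δ⟩⟩, ⟨hε, hδ⟩, hs⟩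
    refine ⟨⟨I ∪ J, min ε δ⟩, lt_min hε hδ, fun R hR => hs ⟨fun x hx => ?_, fun x hx => ?_⟩⟩
    · exact (hR x (Finset.mem_union_left _ hx)).1.trans_le (min_le_left _ _)
    · rw [dist_comm, Real.dist_eq]
      exact (hR x (Finset.mem_union_right _ hx)).2.trans_le (min_le_right _ _)
  · rintro ⟨⟨I, ε⟩, hε, hs⟩
    refine ⟨⟨⟨I, ε⟩, ⟨I, ε⟩⟩, ⟨hε, hε⟩, fun R hR => hs fun x hx => ⟨hR.1 x hx, ?_⟩⟩
    have := hR.2 x hx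
    rw [dist_comm, Real.dist_eq] at this
    exact this

/-- The basic neighbourhoods of the topology of uniform convergence. -/
theorem nhds_tauU_basis {𝕌 : Type u} [MetricSpace 𝕌] (U : Retr 𝕌) :
    (@nhds _ (tauU 𝕌) U).HasBasis (fun ε : ℝ => 0 < ε)
      (fun ε => {R | ∀ x, dist (R.1 x) (U.1 x) < ε}) := by
  refine ⟨fun s => ?_⟩
  rw [tauU, nhds_induced,
    ((UniformFun.hasBasis_nhds_of_basis _ _ _ uniformity_basis_dist).comap _).mem_iff]
  constructor
  · rintro ⟨ε, hε, hs⟩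
    refine ⟨ε, hε, fun R hR => hs fun x => ?_⟩
    have := hR x
    rw [dist_comm] at this
    exact this
  · rintro ⟨ε, hε, hs⟩
    refine ⟨ε, hε, fun R hR => hs fun x => ?_⟩
    have := hR x
    rw [dist_comm]
    exact this

/-!
The point is that a universal ultrahomogeneous retraction is unique up to isometry: if `R` and `S`
are two of them, on complete separable spaces, then some surjective isometry `I` satisfies
`I ∘ R = S ∘ I` (`exists_isometryEquiv_conj`). This is a back-and-forth argument. Universality of
`S` embeds `(X, R, D_R)` into `(Y, S, D_S)`, and ultrahomogeneity of `S` corrects this embedding so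
that it extends any prescribed finite partial isomorphism
(`IsFinitePartialIso.exists_embedding_extending`); hence finite partial isomorphisms can be extended
to any further point, on either side. A sufficiently generic directed family of them has as its
union an isometry between dense sets, which extends by completeness to `I`.

Conjugation by a surjective isometry `I` of `𝕌` preserves retractions, universality and
ultrahomogeneity, carries `ℛ(𝕌, s)` onto `ℛ(𝕌, I[s])`, and is continuous for each of the three
topologies (`continuous_conj`). Density of `𝒰(𝕌, t)` in `ℛ(𝕌, t)` for one `t ∈ T` is therefore
transported to every other member of `T`.
-/

/-! ### Finite partial isomorphisms of retractions -/

/-- A finite partial isomorphism from `(X, R, D_R)` to `(Y, S, D_S)`, encoded as its graph `F`.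
Preservation of distances makes `F` the graph of an injective function. -/
structure IsFinitePartialIso {X Y : Type u} [MetricSpace X] [MetricSpace Y] (R : X → X)
    (S : Y → Y) (F : Set (X × Y)) : Prop where
  finite : F.Finite
  dist_eq : ∀ p ∈ F, ∀ q ∈ F, dist p.1 q.1 = dist p.2 q.2
  map_mem : ∀ p ∈ F, (R p.1, S p.2) ∈ F
  retractDist_eq : ∀ p ∈ F, retractDist R p.1 = retractDist S p.2

/-- An isometric embedding of `(X, R, D_R)` into `(Y, S, D_S)`. -/
structure IsRetractionEmbedding {X Y : Type u} [MetricSpace X] [MetricSpace Y] (R : X → X)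
    (S : Y → Y) (e : X → Y) : Prop where
  isometry : Isometry e
  map_comm : ∀ x, e (R x) = S (e x)
  retractDist_eq : ∀ x, retractDist R x = retractDist S (e x)

section PartialIso

variable {X Y Z : Type u} [MetricSpace X] [MetricSpace Y] [MetricSpace Z]
  {R : X → X} {S : Y → Y} {Q : Z → Z} {F : Set (X × Y)}

theorem IsRetractionEmbedding.comp {f : Y → Z} {e : X → Y} (hf : IsRetractionEmbedding S Q f)
    (he : IsRetractionEmbedding R S e) : IsRetractionEmbedding R Q (f ∘ e) where
  isometry := hf.isometry.comp he.isometry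
  map_comm x := by simp [he.map_comm, hf.map_comm]
  retractDist_eq x := by simp [he.retractDist_eq, hf.retractDist_eq]

/-- A surjective isometry intertwining two self-maps automatically preserves the distance to
their ranges. -/
theorem IsometryEquiv.isRetractionEmbedding (I : X ≃ᵢ Y) (hI : ∀ x, I (R x) = S (I x)) :
    IsRetractionEmbedding R S I where
  isometry := I.isometry
  map_comm := hI
  retractDist_eq x := by
    have hr : range S = I '' range R := by
      rw [← range_comp, ← I.surjective.range_comp S]
      exact congrArg range (funext fun y => (hI y).symm)
    rw [retractDist, retractDist, hr, infDist_image I.isometry]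

namespace IsFinitePartialIso

theorem swap (h : IsFinitePartialIso R S F) : IsFinitePartialIso S R (Prod.swap '' F) where
  finite := h.finite.image _
  dist_eq := by
    rintro _ ⟨p, hp, rfl⟩ _ ⟨q, hq, rfl⟩
    exact (h.dist_eq p hp q hq).symm
  map_mem := by
    rintro _ ⟨p, hp, rfl⟩
    exact ⟨_, h.map_mem p hp, rfl⟩
  retractDist_eq := by
    rintro _ ⟨p, hp, rfl⟩
    exact (h.retractDist_eq p hp).symm

theorem map_fst (h : IsFinitePartialIso R S F) {e : X → Z} (he : IsRetractionEmbedding R Q e) :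
    IsFinitePartialIso Q S (Prod.map e id '' F) where
  finite := h.finite.image _
  dist_eq := by
    rintro _ ⟨p, hp, rfl⟩ _ ⟨q, hq, rfl⟩
    exact (he.isometry.dist_eq _ _).trans (h.dist_eq p hp q hq)
  map_mem := by
    rintro _ ⟨p, hp, rfl⟩
    exact ⟨_, h.map_mem p hp, by simp [he.map_comm]⟩
  retractDist_eq := by
    rintro _ ⟨p, hp, rfl⟩
    exact (he.retractDist_eq _).symm.trans (h.retractDist_eq p hp)

theorem map_snd (h : IsFinitePartialIso R S F) {e : Y → Z} (he : IsRetractionEmbedding S Q e) :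
    IsFinitePartialIso R Q (Prod.map id e '' F) := by
  convert (h.swap.map_fst he).swap using 1
  simp only [image_image]
  rfl

theorem snd_eq (h : IsFinitePartialIso R S F) {p q : X × Y} (hp : p ∈ F) (hq : q ∈ F)
    (hpq : p.1 = q.1) : p.2 = q.2 := by
  rw [← dist_eq_zero, ← h.dist_eq p hp q hq, hpq, dist_self]

/-- The restriction of an embedding to a finite invariant set. -/
theorem of_embedding {e : X → Y} (he : IsRetractionEmbedding R S e) {A : Set X} (hA : A.Finite)
    (hRA : MapsTo R A A) : IsFinitePartialIso R S ((fun x => (x, e x)) '' A) where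
  finite := hA.image _
  dist_eq := by
    rintro _ ⟨x, -, rfl⟩ _ ⟨y, -, rfl⟩
    exact (he.isometry.dist_eq x y).symm
  map_mem := by
    rintro _ ⟨x, hx, rfl⟩
    exact ⟨R x, hRA hx, by simp [he.map_comm]⟩
  retractDist_eq := by
    rintro _ ⟨x, -, rfl⟩
    exact he.retractDist_eq x

end IsFinitePartialIso

/-- Ultrahomogeneity in terms of graphs of finite partial automorphisms. -/
theorem isUltrahomogeneousRetraction_iff :
    IsUltrahomogeneousRetraction R ↔ ∀ F : Set (X × X), IsFinitePartialIso R R F →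
      ∃ I : X ≃ᵢ X, (∀ p ∈ F, I p.1 = p.2) ∧ ∀ x, I (R x) = R (I x) := by
  constructor
  · intro h F hF
    have h₁ : ∀ x : Prod.fst '' F, ∃ y, (x.1, y) ∈ F := by
      rintro ⟨_, p, hp, rfl⟩
      exact ⟨p.2, hp⟩
    have h₂ : ∀ y : Prod.snd '' F, ∃ x, (x, y.1) ∈ F := by
      rintro ⟨_, p, hp, rfl⟩
      exact ⟨p.1, hp⟩
    choose f hf using h₁
    choose g hg using h₂
    let i : Prod.fst '' F ≃ᵢ Prod.snd '' F := IsometryEquiv.mk'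
      (fun x => ⟨f x, _, hf x, rfl⟩) (fun y => ⟨g y, _, hg y, rfl⟩)
      (fun y => Subtype.ext (hF.snd_eq (hf ⟨g y, _, hg y, rfl⟩) (hg y) rfl))
      (Isometry.of_dist_eq fun x y => (hF.dist_eq _ (hf x) _ (hf y)).symm)
    have hR : MapsTo R (Prod.fst '' F) (Prod.fst '' F) := by
      rintro _ ⟨p, hp, rfl⟩
      exact ⟨_, hF.map_mem p hp, rfl⟩
    obtain ⟨I, hI, hI'⟩ := h _ _ hR i (hF.finite.image _) (hF.finite.image _)
      (fun x => hF.snd_eq (hf ⟨R x, hR x.2⟩) (hF.map_mem _ (hf x)) rfl)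
      (fun x => hF.retractDist_eq _ (hf x))
    refine ⟨I, fun p hp => ?_, fun x => (hI' x).1⟩
    have hp' : p.1 ∈ Prod.fst '' F := ⟨p, hp, rfl⟩
    exact (hI ⟨p.1, hp'⟩).trans (hF.snd_eq (hf ⟨p.1, hp'⟩) hp rfl)
  · intro h A₁ A₂ hU i hA₁ _ hcomm hdist
    have := hA₁.to_subtype
    obtain ⟨I, hI, hI'⟩ := h (range fun x : A₁ => ((x : X), (i x : X)))
      { finite := finite_range _
        dist_eq := by
          rintro _ ⟨x, rfl⟩ _ ⟨y, rfl⟩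
          exact (i.isometry.dist_eq x y).symm
        map_mem := by
          rintro _ ⟨x, rfl⟩
          exact ⟨⟨R x, hU x.2⟩, Prod.ext rfl (hcomm x)⟩
        retractDist_eq := by
          rintro _ ⟨x, rfl⟩
          exact hdist x }
    exact ⟨I, fun x => hI _ ⟨x, rfl⟩,
      fun x => ⟨hI' x, (I.isRetractionEmbedding hI').retractDist_eq x⟩⟩

/-! ### Back and forth -/

theorem IsFinitePartialIso.exists_embedding_extending [TopologicalSpace.SeparableSpace X]
    (hR : IsLipRetraction R) (hS : IsUniversalRetraction S) (hS' : IsUltrahomogeneousRetraction S)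
    (hF : IsFinitePartialIso R S F) :
    ∃ e : X → Y, IsRetractionEmbedding R S e ∧ ∀ p ∈ F, e p.1 = p.2 := by
  obtain ⟨i, hi, hi'⟩ := hS X R hR
  have hi : IsRetractionEmbedding R S i := ⟨hi, fun x => (hi' x).1, fun x => (hi' x).2⟩
  obtain ⟨I, hI, hI'⟩ := isUltrahomogeneousRetraction_iff.1 hS' _ (hF.map_fst hi)
  exact ⟨I ∘ i, (I.isRetractionEmbedding hI').comp hi, fun p hp => hI _ ⟨p, hp, rfl⟩⟩

theorem IsFinitePartialIso.exists_superset_fst [TopologicalSpace.SeparableSpace X]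
    (hR : IsLipRetraction R) (hS : IsUniversalRetraction S) (hS' : IsUltrahomogeneousRetraction S)
    (hF : IsFinitePartialIso R S F) (x : X) :
    ∃ G, IsFinitePartialIso R S G ∧ F ⊆ G ∧ ∃ y, (x, y) ∈ G := by
  obtain ⟨e, he, heF⟩ := hF.exists_embedding_extending hR hS hS'
  refine ⟨_, .of_embedding he (A := Prod.fst '' F ∪ {x, R x})
    ((hF.finite.image _).union (by simp)) ?_, fun p hp => ?_, e x, x, by simp, rfl⟩
  · rintro y (⟨p, hp, rfl⟩ | rfl | rfl)
    · exact .inl ⟨_, hF.map_mem p hp, rfl⟩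
    · simp
    · simp [hR.2]
  · exact ⟨p.1, .inl ⟨p, hp, rfl⟩, Prod.ext rfl (heF p hp)⟩

theorem IsFinitePartialIso.exists_superset_snd [TopologicalSpace.SeparableSpace Y]
    (hS : IsLipRetraction S) (hR : IsUniversalRetraction R) (hR' : IsUltrahomogeneousRetraction R)
    (hF : IsFinitePartialIso R S F) (y : Y) :
    ∃ G, IsFinitePartialIso R S G ∧ F ⊆ G ∧ ∃ x, (x, y) ∈ G := by
  obtain ⟨G, hG, hFG, x, hx⟩ := hF.swap.exists_superset_fst hS hR hR' y
  exact ⟨_, hG.swap, fun p hp => ⟨_, hFG ⟨p, hp, rfl⟩, rfl⟩, x, _, hx, rfl⟩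

/-- A distance-preserving relation with dense domain and dense range is contained in the graph of
a surjective isometry. -/
theorem exists_isometryEquiv_of_dense_relation [CompleteSpace X] [CompleteSpace Y]
    (G : Set (X × Y)) (hG : ∀ p ∈ G, ∀ q ∈ G, dist p.1 q.1 = dist p.2 q.2)
    (h₁ : Dense (Prod.fst '' G)) (h₂ : Dense (Prod.snd '' G)) :
    ∃ I : X ≃ᵢ Y, ∀ p ∈ G, I p.1 = p.2 := by
  have i₁ : Isometry fun p : G => p.1.1 := Isometry.of_dist_eq fun p q => by
    rw [Subtype.dist_eq, Prod.dist_eq, ← hG p p.2 q q.2, max_self]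
  have i₂ : Isometry fun p : G => p.1.2 := Isometry.of_dist_eq fun p q => by
    rw [Subtype.dist_eq, Prod.dist_eq, ← hG p p.2 q q.2, max_self]
  -- Both spaces are completions of `G`.
  let c₁ : AbstractCompletion G := ⟨X, fun p => p.1.1, inferInstance, inferInstance, inferInstance,
    i₁.isUniformInducing, by rwa [image_eq_range] at h₁⟩
  let c₂ : AbstractCompletion G := ⟨Y, fun p => p.1.2, inferInstance, inferInstance, inferInstance,
    i₂.isUniformInducing, by rwa [image_eq_range] at h₂⟩
  let I : X ≃ Y := (c₁.compareEquiv c₂).toEquiv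
  have hI : Continuous I := (c₁.compareEquiv c₂).continuous
  have hIG : ∀ p : G, I p.1.1 = p.1.2 := c₁.compare_coe c₂
  refine ⟨⟨I, Isometry.of_dist_eq fun x y => ?_⟩, fun p hp => hIG ⟨p, hp⟩⟩
  refine c₁.dense.induction_on₂ (p := fun x y : X => dist (I x) (I y) = dist x y)
    (isClosed_eq (by fun_prop) (by fun_prop)) (fun p q => ?_) x y
  change dist (I p.1.1) (I q.1.1) = dist p.1.1 q.1.1
  rw [hIG, hIG, hG p p.2 q q.2]

/-- Universal ultrahomogeneous retractions of complete separable spaces are unique up to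
isometry. -/
theorem exists_isometryEquiv_conj [CompleteSpace X] [CompleteSpace Y]
    [TopologicalSpace.SeparableSpace X] [TopologicalSpace.SeparableSpace Y]
    (hR : IsLipRetraction R) (hRu : IsUniversalRetraction R) (hRh : IsUltrahomogeneousRetraction R)
    (hS : IsLipRetraction S) (hSu : IsUniversalRetraction S)
    (hSh : IsUltrahomogeneousRetraction S) :
    ∃ I : X ≃ᵢ Y, ∀ x, I (R x) = S (I x) := by
  obtain ⟨A, hA, hAd⟩ := TopologicalSpace.exists_countable_dense X
  obtain ⟨B, hB, hBd⟩ := TopologicalSpace.exists_countable_dense Y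
  have := hA.toEncodable
  have := hB.toEncodable
  let P := {F : Set (X × Y) // IsFinitePartialIso R S F}
  let D : A ⊕ B → Order.Cofinal P := Sum.elim
    (fun a => ⟨{F | ∃ y, (a.1, y) ∈ F.1}, fun F => by
      obtain ⟨G, hG, hFG, h⟩ := F.2.exists_superset_fst hR hSu hSh a.1
      exact ⟨⟨G, hG⟩, h, hFG⟩⟩)
    (fun b => ⟨{F | ∃ x, (x, b.1) ∈ F.1}, fun F => by
      obtain ⟨G, hG, hFG, h⟩ := F.2.exists_superset_snd hS hRu hRh b.1
      exact ⟨⟨G, hG⟩, h, hFG⟩⟩)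
  let p₀ : P := ⟨∅, by simp, by simp, by simp, by simp⟩
  let J := Order.idealOfCofinals p₀ D
  have hJ : ∀ i, ∃ F, F ∈ D i ∧ F ∈ J := Order.cofinal_meets_idealOfCofinals p₀ D
  let G : Set (X × Y) := {p | ∃ F ∈ J, p ∈ F.1}
  have hGR : ∀ p ∈ G, (R p.1, S p.2) ∈ G := by
    rintro p ⟨F, hF, hp⟩
    exact ⟨F, hF, F.2.map_mem p hp⟩
  have h₁ : Dense (Prod.fst '' G) := hAd.mono fun a ha => by
    obtain ⟨F, ⟨y, hy⟩, hF⟩ := hJ (.inl ⟨a, ha⟩)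
    exact ⟨_, ⟨F, hF, hy⟩, rfl⟩
  have h₂ : Dense (Prod.snd '' G) := hBd.mono fun b hb => by
    obtain ⟨F, ⟨x, hx⟩, hF⟩ := hJ (.inr ⟨b, hb⟩)
    exact ⟨_, ⟨F, hF, hx⟩, rfl⟩
  obtain ⟨I, hI⟩ := exists_isometryEquiv_of_dense_relation G (by
    rintro p ⟨F, hF, hp⟩ q ⟨F', hF', hq⟩
    obtain ⟨E, -, hFE, hFE'⟩ := J.directed F hF F' hF'
    exact E.2.dist_eq p (hFE hp) q (hFE' hq)) h₁ h₂
  refine ⟨I, fun x => congrFun (Continuous.ext_on (f := I ∘ R) (g := S ∘ I) h₁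
    (I.continuous.comp hR.1.continuous) (hS.1.continuous.comp I.continuous) ?_) x⟩
  rintro _ ⟨p, hp, rfl⟩
  rw [Function.comp_apply, Function.comp_apply, hI p hp, hI _ (hGR p hp)]

end PartialIso

/-! ### Conjugation by an isometry -/

section Conj

variable {𝕌 : Type u} [MetricSpace 𝕌]

/-- The conjugate `I ∘ R ∘ I⁻¹` of a retraction `R` by a surjective isometry `I`. -/
def Retr.conj (I : 𝕌 ≃ᵢ 𝕌) (R : Retr 𝕌) : Retr 𝕌 :=
  ⟨I ∘ R.1 ∘ I.symm, by
    simpa using I.isometry.lipschitz.comp (R.2.1.comp I.symm.isometry.lipschitz),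
    fun x => by simp [R.2.2]⟩

theorem Retr.conj_conj_symm (I : 𝕌 ≃ᵢ 𝕌) (R : Retr 𝕌) : (R.conj I.symm).conj I = R :=
  Subtype.ext (funext fun x => by simp [Retr.conj])

theorem Retr.range_conj (I : 𝕌 ≃ᵢ 𝕌) (R : Retr 𝕌) : range (R.conj I).1 = I '' range R.1 := by
  rw [← range_comp, ← I.symm.surjective.range_comp (I ∘ R.1)]
  rfl

theorem Retr.isRetractionEmbedding_conj (I : 𝕌 ≃ᵢ 𝕌) (R : Retr 𝕌) :
    IsRetractionEmbedding R.1 (R.conj I).1 I :=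
  I.isRetractionEmbedding fun x => by simp [Retr.conj]

theorem Retr.isRetractionEmbedding_conj_symm (I : 𝕌 ≃ᵢ 𝕌) (R : Retr 𝕌) :
    IsRetractionEmbedding (R.conj I).1 R.1 I.symm :=
  I.symm.isRetractionEmbedding fun x => by simp [Retr.conj]

theorem conj_mem_univRetr (I : 𝕌 ≃ᵢ 𝕌) {U : Retr 𝕌} (hU : U ∈ univRetr 𝕌) :
    U.conj I ∈ univRetr 𝕌 := by
  have hI := U.isRetractionEmbedding_conj I
  have hI' := U.isRetractionEmbedding_conj_symm I
  refine ⟨fun X _ _ R hR => ?_, isUltrahomogeneousRetraction_iff.2 fun F hF => ?_⟩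
  · obtain ⟨i, hi, h⟩ := hU.1 X R hR
    have he := hI.comp ⟨hi, fun x => (h x).1, fun x => (h x).2⟩
    exact ⟨_, he.isometry, fun x => ⟨he.map_comm x, he.retractDist_eq x⟩⟩
  · obtain ⟨K, hK, hK'⟩ := isUltrahomogeneousRetraction_iff.1 hU.2 _
      ((hF.map_fst hI').map_snd hI')
    refine ⟨(I.symm.trans K).trans I, fun p hp => ?_, fun x => ?_⟩
    · have : K (I.symm p.1) = I.symm p.2 := hK _ ⟨_, ⟨p, hp, rfl⟩, rfl⟩
      simp [this]
    · simp [Retr.conj, hK']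

theorem continuous_conj (I : 𝕌 ≃ᵢ 𝕌) {τ : TopologicalSpace (Retr 𝕌)}
    (hτ : τ = tauP 𝕌 ∨ τ = tauPR 𝕌 ∨ τ = tauU 𝕌) : Continuous (Retr.conj I) := by
  obtain rfl | rfl | rfl := hτ
  · let := tauP 𝕌
    refine continuous_induced_rng.2 (continuous_pi fun x => ?_)
    exact I.continuous.comp ((continuous_apply (I.symm x)).comp continuous_induced_dom)
  · let := tauPR 𝕌
    have hc : Continuous fun R : Retr 𝕌 => (R.1, retractDist R.1) :=
      continuous_induced_dom
    refine continuous_induced_rng.2 (.prodMk (continuous_pi fun x => ?_)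
      (continuous_pi fun x => ?_))
    · exact I.continuous.comp ((continuous_apply (I.symm x)).comp (continuous_fst.comp hc))
    · refine ((continuous_apply (I.symm x)).comp (continuous_snd.comp hc)).congr fun R => ?_
      exact ((R.isRetractionEmbedding_conj_symm I).retractDist_eq x).symm
  · let := tauU 𝕌
    refine continuous_induced_rng.2 ?_
    exact (UniformFun.postcomp_uniformContinuous I.isometry.uniformContinuous).continuous.comp
      ((UniformFun.precomp_uniformContinuous (f := I.symm)).continuous.comp continuous_induced_dom)

end Conj

/-! ### Density in a subspace -/

theorem denseInSubspace_iff {Z : Type u} {τ : TopologicalSpace Z} {A B : Set Z} :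
    DenseInSubspace τ A B ↔ A ⊆ B ∧ B ⊆ closure A := by
  refine and_congr_right fun hAB => ?_
  rw [Subtype.dense_iff, Subtype.image_preimage_coe, inter_eq_right.2 hAB]

theorem DenseInSubspace.closureInSubspace_eq {Z : Type u} {τ : TopologicalSpace Z} {A B : Set Z}
    (h : DenseInSubspace τ A B) : closureInSubspace τ A B = B := by
  rw [closureInSubspace, h.2.closure_eq, image_univ, Subtype.range_val]

theorem mainTheorem9 {𝕌 : Type u} [MetricSpace 𝕌] (h𝕌 : IsUrysohn 𝕌)
    (τ : TopologicalSpace (Retr 𝕌)) (hτ : τ = tauP 𝕌 ∨ τ = tauPR 𝕌 ∨ τ = tauU 𝕌)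
    (h : ∃ t ∈ univRetracts 𝕌, DenseInSubspace τ (univRetrOnto t) (retrOnto t)) :
    DenseInSubspace τ (univRetr 𝕌) (retrOntoUnivRetracts 𝕌) ∧
      closureInSubspace τ (univRetr 𝕌) (retrOntoUnivRetracts 𝕌) = retrOntoUnivRetracts 𝕌 := by
  suffices hd : DenseInSubspace τ (univRetr 𝕌) (retrOntoUnivRetracts 𝕌) from
    ⟨hd, hd.closureInSubspace_eq⟩
  have := h𝕌.complete
  have := h𝕌.separable
  obtain ⟨_, ⟨U, hU, rfl⟩, hdense⟩ := h
  -- With `range R = range V` and `V` conjugate to `U` by `I`, the retraction `R` is the conjugate of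
  -- a member of `ℛ(𝕌, range U)`, which the hypothesis approximates by members of `𝒰(𝕌, range U)`.
  refine denseInSubspace_iff.2
    ⟨fun V hV => mem_iUnion₂.2 ⟨_, ⟨V, hV, rfl⟩, rfl⟩, fun R hR => ?_⟩
  obtain ⟨_, ⟨V, hV, rfl⟩, hRV⟩ := mem_iUnion₂.1 hR
  obtain ⟨I, hI⟩ := exists_isometryEquiv_conj U.2 hU.1 hU.2 V.2 hV.1 hV.2
  have hVU : V = U.conj I := Subtype.ext (funext fun x => by simp [Retr.conj, hI])
  have hR' : R.conj I.symm ∈ retrOnto (range U.1) := by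
    change range R.1 = range V.1 at hRV
    change range (R.conj I.symm).1 = range U.1
    rw [Retr.range_conj, hRV, hVU, Retr.range_conj, ← image_comp]
    simp
  rw [← R.conj_conj_symm I]
  exact map_mem_closure (continuous_conj I hτ) ((denseInSubspace_iff.1 hdense).2 hR')
    fun W hW => conj_mem_univRetr I hW.1
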